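/- Let $\mathcal A=\{H_i\}_{i\in I}$ be a finite (not necessarily central) arrangement of affine hyperplanes in a real vector space $V$. For each $i$ let $H_i^+$ and $H_i^-$ be the two open half-spaces bounded by $H_i$, and put $H_i^0=H_i$. The faces of $\mathcal A$ are the nonempty sets $F=\bigcap_{i\in I}H_i^{\sigma_i(F)}$ with $\sigma_i(F)\in\{+,-,0\}$; the chambers are the faces with $\sigma_i(F)\neq 0$ for all $i$. Write $F\le G$ ($F$ is a face of $G$) if, for each $i$, $\sigma_i(F)=0$ or $\sigma_i(F)=\sigma_i(G)$. The product $FG$ of two faces is the face with $\sigma_i(FG)=\sigma_i(F)$ if $\sigma_i(F)\neq0$ and $\sigma_i(FG)=\sigma_i(G)$ otherwise. Let $\mathcal L$ be the set of all nonempty intersections $X=\bigcap_{H\in\mathcal A'}H$ with $\mathcal A'\subseteq\mathcal A$ (including $V$, for $\mathcal A'=\emptyset$), ordered by inclusion, and let $\mu$ be its Möbius function. Let $\mathcal D$ be a convex set of chambers, that is, for some $J\subseteq I$ and signs $\sigma_i\in\{+,-\}$ ($i\in J$), $\mathcal D$ is the set of all chambers contained in $U=\bigcap_{i\in J}H_i^{\sigma_i}$,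 and $\mathcal D\neq\emptyset$. Let $\mathcal G$ be the set of all faces of the chambers in $\mathcal D$, and let $\mathcal M_0$ be the set of those $X\in\mathcal L$ with $X\cap U\neq\emptyset$. **Theorem.** Let $\{w_G\}_{G\in\mathcal G}$ be any probability distribution on $\mathcal G$, and let $P$ be the transition matrix of the random walk on $\mathcal D$ driven by it, $$P(C,C')=\sum_{G\in\mathcal G,\ GC=C'}w_G\qquad(C,C'\in\mathcal D).$$ Then $P$ is diagonalizable over $\mathbb R$. For each $X\in\mathcal M_0$ it has the eigenvalue $$\lambda_X=\sum_{G\in\mathcal G,\ G\subseteq X}w_G$$ with multiplicity $|\mu(X,V)|$, and these are all the eigenvalues: the characteristic polynomial of $P$ is $\prod_{X\in\mathcal M_0}(t-\lambda_X)^{|\mu(X,V)|}$. (If several of the $\lambda_X$ coincide, their multiplicities add.) -/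

import Mathlib

/-- A finite (not necessarily central) arrangement of affine hyperplanes in a real vector space `V`,
indexed by `I`.  The hyperplane `H i` is given by an equation `form i = 0`, where `form i` is a
nonconstant affine function; its positive side is the side where `form i > 0`. -/
structure HypArrangement (V : Type*) [AddCommGroup V] [Module ℝ V] (I : Type*) where
  form : I → V →ᵃ[ℝ] ℝ
  nonconst : ∀ i, (form i).linear ≠ 0

namespace HypArrangement

variable {V : Type*} [AddCommGroup V] [Module ℝ V] {I : Type*}

/-- The hyperplane `H i`. -/
def hyperplane (A : HypArrangement V I) (i : I) : Set V := {v | A.form i v = 0}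

/-- The sign sequence of a point. -/
noncomputable def signSeq (A : HypArrangement V I) (v : V) : I → SignType :=
  fun i => SignType.sign (A.form i v)

/-- A face of the arrangement, encoded by its sign sequence: the sign sequences which occur are
those for which the corresponding subset of `V` (see `Face.carrier`) is nonempty. -/
@[ext]
structure Face (A : HypArrangement V I) where
  sgn : I → SignType
  realized : ∃ v, A.signSeq v = sgn

variable {A : HypArrangement V I}

/-- The face as a subset of `V`. -/
def Face.carrier (F : A.Face) : Set V := {v | ∀ i, SignType.sign (A.form i v) = F.sgn i}

/-- Chambers are the faces that lie on no hyperplane. -/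
def Face.IsChamber (F : A.Face) : Prop := ∀ i, F.sgn i ≠ 0

/-- The face relation: `F` is a face of `G`. -/
def Face.IsFaceOf (F G : A.Face) : Prop := ∀ i, F.sgn i = 0 ∨ F.sgn i = G.sgn i

theorem exists_signSeq_eq_mul [Finite I] (A : HypArrangement V I) (v w : V) :
    ∃ u, A.signSeq u =
      fun i => if A.signSeq v i ≠ 0 then A.signSeq v i else A.signSeq w i := by
  have key : ∀ i, ∀ᶠ t : ℝ in nhdsWithin 0 (Set.Ioi 0),
      A.signSeq (AffineMap.lineMap v w t) i =
        if A.signSeq v i ≠ 0 then A.signSeq v i else A.signSeq w i := by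
    intro i
    have hval : ∀ t : ℝ, A.form i (AffineMap.lineMap v w t)
        = A.form i v + t * (A.form i w - A.form i v) := by
      intro t
      rw [AffineMap.apply_lineMap, AffineMap.lineMap_apply]
      simp only [vsub_eq_sub, smul_eq_mul, vadd_eq_add]
      ring
    have hlim : Filter.Tendsto (fun t : ℝ => A.form i v + t * (A.form i w - A.form i v))
        (nhdsWithin 0 (Set.Ioi 0)) (nhds (A.form i v)) := by
      have hc : Continuous fun t : ℝ => A.form i v + t * (A.form i w - A.form i v) := by
        fun_prop
      have h0 := hc.tendsto 0
      simp only [zero_mul, add_zero] at h0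
      exact h0.mono_left nhdsWithin_le_nhds
    rcases lt_trichotomy (A.form i v) 0 with h | h | h
    · filter_upwards [hlim.eventually (gt_mem_nhds h)] with t ht
      simp [signSeq, hval, sign_neg ht, sign_neg h]
    · filter_upwards [self_mem_nhdsWithin] with t ht
      simp only [signSeq, hval, h, sign_zero, zero_add, sub_zero, sign_mul]
      rw [sign_pos ht]
      simp
    · filter_upwards [hlim.eventually (lt_mem_nhds h)] with t ht
      simp [signSeq, hval, sign_pos ht, sign_pos h]
  obtain ⟨t, ht⟩ := (Filter.eventually_all.2 key).exists
  exact ⟨AffineMap.lineMap v w t, funext ht⟩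

/-- The product of faces. -/
instance [Finite I] : Mul A.Face where
  mul F G :=
    { sgn := fun i => if F.sgn i ≠ 0 then F.sgn i else G.sgn i
      realized := by
        obtain ⟨v, hv⟩ := F.realized
        obtain ⟨w, hw⟩ := G.realized
        rw [← hv, ← hw]
        exact A.exists_signSeq_eq_mul v w }

/-- The intersection semilattice: nonempty intersections of hyperplanes of the arrangement
(the empty intersection being `V`), ordered by inclusion. -/
def Flat (A : HypArrangement V I) : Type _ :=
  {X : Set V // X.Nonempty ∧ ∃ T : Set I, X = ⋂ i ∈ T, A.hyperplane i}

instance : PartialOrder A.Flat := 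
  inferInstanceAs (PartialOrder
    {X : Set V // X.Nonempty ∧ ∃ T : Set I, X = ⋂ i ∈ T, A.hyperplane i})

/-- The flat `V`. -/
def Flat.whole (A : HypArrangement V I) : A.Flat := ⟨Set.univ, ⟨0, trivial⟩, ∅, by simp⟩

instance [Finite I] : Finite A.Face :=
  Finite.of_injective (fun F : A.Face => F.sgn) fun _ _ h => Face.ext h

instance [Finite I] : Finite A.Flat := by
  refine Finite.of_injective (fun X : A.Flat => X.2.2.choose) fun X Y h => Subtype.ext ?_
  rw [X.2.2.choose_spec, Y.2.2.choose_spec]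
  exact congrArg (fun T : Set I => ⋂ i ∈ T, A.hyperplane i) h

noncomputable instance [Finite I] (S : Set A.Face) : Fintype S := Fintype.ofFinite _

noncomputable instance [Finite I] (S : Set A.Flat) : Fintype S := Fintype.ofFinite _

noncomputable instance : DecidableEq A.Face := Classical.decEq _

noncomputable instance : DecidableEq A.Flat := Classical.decEq _

open scoped Classical in
noncomputable instance [Finite I] : LocallyFiniteOrder A.Flat :=
  letI : Fintype A.Flat := Fintype.ofFinite _
  Fintype.toLocallyFiniteOrder

/-- The intersection of the open half-spaces `H i ^ (σ i)` with `i ∈ J`. -/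
def openRegion (A : HypArrangement V I) (J : Set I) (σ : I → SignType) : Set V :=
  {v | ∀ i ∈ J, SignType.sign (A.form i v) = σ i}

/-- The set of chambers on the `σ i` side of `H i`, for all `i ∈ J`. -/
def chambersIn (A : HypArrangement V I) (J : Set I) (σ : I → SignType) : Set A.Face :=
  {C | C.IsChamber ∧ ∀ i ∈ J, C.sgn i = σ i}

/-- All faces of the chambers in `D`. -/
def facesOf (D : Set A.Face) : Set A.Face := {G | ∃ C ∈ D, G.IsFaceOf C}

/-- The flats that meet the set `U`. -/
def flatsMeeting (A : HypArrangement V I) (U : Set V) : Set A.Flat := {X | (X.1 ∩ U).Nonempty}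

/-- The transition matrix of the walk on `D` driven by the weights `w`: from `C`, move to `G * C`
with probability `w G`. -/
noncomputable def transition [Finite I] (D : Set A.Face) (w : facesOf D → ℝ) : Matrix D D ℝ :=
  fun C C' => ∑ G : facesOf D, if (G : A.Face) * (C : A.Face) = (C' : A.Face) then w G else 0

open scoped Classical in
/-- The sum of the weights of the faces contained in the flat `X`. -/
noncomputable def flatWeight [Finite I] (D : Set A.Face) (w : facesOf D → ℝ) (X : A.Flat) : ℝ :=
  ∑ G : facesOf D, if (G : A.Face).carrier ⊆ X.1 then w G else 0

/-- The absolute value of the Möbius number `μ(X, V)` of the intersection semilattice. -/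
noncomputable def absMobius [Finite I] (X : A.Flat) : ℕ :=
  (IncidenceAlgebra.mu ℤ X (Flat.whole A)).natAbs

end HypArrangement

/-- A square real matrix that is diagonalizable over `ℝ`. -/
def Matrix.IsRealDiagonalizable {n : Type*} [Fintype n] [DecidableEq n] (M : Matrix n n ℝ) : Prop :=
  ∃ (Q : Matrix n n ℝ) (d : n → ℝ), IsUnit Q ∧ M * Q = Q * Matrix.diagonal d

/-! Let `M_G` be the matrix of left multiplication by `G` on chambers, so that `P = ∑ w_G M_G`.
Diagonalizability: for faces `F`, `G` of chambers in `D`, `FG = F` when `G` lies in the support of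
`F`; otherwise `FG` has a larger support, hence a strictly larger support weight if `w_G > 0`. So `P
- λ_F` sends `M_F` to a combination of matrices `M_{FG}` of larger weight, and `P` is annihilated by
a product of distinct linear factors (`aeval_prod_mul_mulMatrix`). Multiplicities: `tr M_G` counts
the chambers of `D` fixed by `G`, which again form a convex set. Zaslavsky's formula
(`card_chambersIn`) evaluates it as the sum of `|μ(X,V)|` over the flats `X` that meet `U` and
contain `G`. As `FG ⊆ X` iff `F, G ⊆ X`, induction gives `tr P^m = ∑ |μ(X,V)| λ_X^m`, and these
power sums determine the characteristic polynomial of a diagonalizable matrix. Zaslavsky's formula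
comes from an Euler relation for open cells (`sum_neg_one_pow_codim`) and the sign alternation of
`μ` (`neg_one_pow_codim_mul_mu_pos`). -/

/-! ### Diagonalizable matrices and power sums of eigenvalues. -/

open Polynomial in
theorem Matrix.isRealDiagonalizable_of_prod_sub_eq_zero {n : Type*} [Fintype n] [DecidableEq n]
    (M : Matrix n n ℝ) (s : Finset ℝ) (h : aeval M (∏ l ∈ s, (X - C l)) = 0) :
    M.IsRealDiagonalizable := by
  classical
  let E : Set (n → ℝ) := {v | ∃ l : ℝ, M.mulVec v = l • v}
  have hspan : ⊤ ≤ Submodule.span ℝ E := by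
    intro v _
    rcases s.eq_empty_or_nonempty with rfl | hs
    · have : (1 : Matrix n n ℝ) = 0 := by simpa using h
      have hv : v = 0 := by rw [← Matrix.one_mulVec v, this, Matrix.zero_mulVec]
      rw [hv]; exact Submodule.zero_mem _
    -- The Lagrange basis polynomials `L_l` on `s` sum to 1, so `v = ∑ L_l(M) v`. Each summand is in
    -- the `l`-eigenspace because `(X - l) L_l` is a multiple of the annihilating product.
    have h1 := congrArg (aeval M) (Lagrange.sum_basis (v := (id : ℝ → ℝ))
      (Function.injective_id.injOn) hs)
    rw [map_sum, map_one] at h1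
    rw [← Matrix.one_mulVec v, ← h1, Matrix.sum_mulVec]
    refine Submodule.sum_mem _ fun l hl => Submodule.subset_span ⟨l, ?_⟩
    have h2 : aeval M ((X - C l) * Lagrange.basis s id l) = 0 := by
      have : (X - C l) * Lagrange.basis s (id : ℝ → ℝ) l
          = (∏ l ∈ s, (X - C l)) * C (∏ j ∈ s.erase l, (l - j)⁻¹) := by
        rw [Lagrange.basis, ← Finset.mul_prod_erase s _ hl, map_prod, mul_assoc,
          ← Finset.prod_mul_distrib]
        simp [Lagrange.basisDivisor, mul_comm]
      rw [this, map_mul, h, zero_mul]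
    have h3 : M * aeval M (Lagrange.basis s id l) = l • aeval M (Lagrange.basis s id l) := by
      rw [map_mul, map_sub, aeval_X, aeval_C, sub_mul, sub_eq_zero] at h2
      rw [h2, Algebra.algebraMap_eq_smul_one, smul_mul_assoc, one_mul]
    rw [Matrix.mulVec_mulVec, h3, Matrix.smul_mulVec]
  let b₀ := Module.Basis.ofSpan hspan
  have : Fintype _ := FiniteDimensional.fintypeBasisIndex b₀
  have hcard : Fintype.card _ = Fintype.card n :=
    (Module.finrank_eq_card_basis b₀).symm.trans (by simp)
  let b := b₀.reindex (Fintype.equivOfCardEq hcard)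
  have hb : ∀ j, ∃ l : ℝ, M.mulVec (b j) = l • b j := by
    intro j
    apply Module.Basis.ofSpan_subset hspan
    exact ⟨(Fintype.equivOfCardEq hcard).symm j, by simp [b, b₀]⟩
  choose d hd using hb
  refine ⟨(Pi.basisFun ℝ n).toMatrix b, d, ?_, ?_⟩
  · have := (Pi.basisFun ℝ n).invertibleToMatrix b
    exact isUnit_of_invertible _
  · ext i j
    have := congrFun (hd j) i
    simpa [Matrix.mul_apply, Matrix.mulVec, dotProduct, Module.Basis.toMatrix_apply,
      Matrix.diagonal_apply, mul_comm] using this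

-- The trace identities extend linearly from monomials to all polynomials. A Lagrange basis
-- polynomial on the union of both sets of values then isolates the multiplicity of each value.
open Polynomial in
theorem Matrix.IsRealDiagonalizable.charpoly_eq {n β : Type*} [Fintype n] [DecidableEq n]
    [Fintype β] {M : Matrix n n ℝ} (hM : M.IsRealDiagonalizable) (e : β → ℝ) (k : β → ℕ)
    (h : ∀ m : ℕ, (M ^ m).trace = ∑ b, k b * e b ^ m) :
    M.charpoly = ∏ b, (X - C (e b)) ^ k b := by
  classical
  obtain ⟨Q, d, ⟨u, rfl⟩, hQ⟩ := hM
  have hMd : M = u.1 * Matrix.diagonal d * u⁻¹.1 := by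
    rw [← hQ, mul_assoc, Units.mul_inv, mul_one]
  have hchar : M.charpoly = ∏ j, (X - C (d j)) := by
    rw [hMd, Matrix.coe_units_inv, Matrix.charpoly_units_conj, Matrix.charpoly_diagonal]
  have hpow : ∀ m : ℕ, M ^ m = u.1 * Matrix.diagonal (d ^ m) * u⁻¹.1 := by
    intro m
    rw [hMd, Units.conj_pow, Matrix.diagonal_pow]
  have htr : ∀ m : ℕ, ∑ j, d j ^ m = ∑ b, (k b : ℝ) * e b ^ m := by
    intro m
    rw [← h m, hpow, Matrix.trace_units_conj, Matrix.trace_diagonal]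
    simp
  have hpoly : ∀ p : ℝ[X], ∑ j, p.eval (d j) = ∑ b, (k b : ℝ) * p.eval (e b) := by
    intro p
    simp only [Polynomial.eval_eq_sum_range, Finset.mul_sum]
    rw [Finset.sum_comm, Finset.sum_comm (s := Finset.univ (α := β))]
    refine Finset.sum_congr rfl fun m _ => ?_
    rw [← Finset.mul_sum, htr, Finset.mul_sum]
    exact Finset.sum_congr rfl fun _ _ => by ring
  set T : Finset ℝ := Finset.univ.image d ∪ Finset.univ.image e with hT
  have hdT : ∀ j, d j ∈ T := fun j => by simp [hT]
  have heT : ∀ b, e b ∈ T := fun b => by simp [hT]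
  have hbasis : ∀ l ∈ T, ∀ x ∈ T,
      (Lagrange.basis T (id : ℝ → ℝ) l).eval x = if x = l then 1 else 0 := by
    intro l hl x hx
    split_ifs with hxl
    · subst hxl
      exact Lagrange.eval_basis_self (v := id) Function.injective_id.injOn hx
    · exact Lagrange.eval_basis_of_ne (v := id) (Ne.symm hxl) hx
  have hcount : ∀ l ∈ T, (Finset.univ.filter fun j => d j = l).card
      = ∑ b ∈ Finset.univ.filter (fun b => e b = l), k b := by
    intro l hl
    have := hpoly (Lagrange.basis T id l)
    simp only [hbasis l hl _ (hdT _), hbasis l hl _ (heT _)] at this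
    simp only [mul_ite, mul_one, mul_zero, ← Finset.sum_filter] at this
    rw [Finset.sum_const, nsmul_eq_mul, mul_one] at this
    exact_mod_cast this
  rw [hchar, ← Finset.prod_fiberwise_of_maps_to (fun j _ => hdT j),
    ← Finset.prod_fiberwise_of_maps_to (fun b _ => heT b)]
  refine Finset.prod_congr rfl fun l hl => ?_
  have h1 : ∏ j with d j = l, (X - C (d j)) = (X - C l) ^ (Finset.univ.filter fun j => d j = l).card :=
    Finset.prod_eq_pow_card fun j hj => by rw [(Finset.mem_filter.1 hj).2]
  have h2 : ∏ b with e b = l, (X - C (e b)) ^ k b = ∏ b with e b = l, (X - C l) ^ k b :=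
    Finset.prod_congr rfl fun b hb => by rw [(Finset.mem_filter.1 hb).2]
  rw [h1, h2, Finset.prod_pow_eq_pow_sum, hcount l hl]

/-! ### Codimension and the Euler relation. -/

theorem finrank_quotient_inf_ker {V : Type*} [AddCommGroup V] [Module ℝ V] (W : Submodule ℝ V)
    [FiniteDimensional ℝ (V ⧸ W)] (φ : V →ₗ[ℝ] ℝ) {e : V} (he : e ∈ W) (hφ : φ e ≠ 0) :
    Module.finrank ℝ (V ⧸ W ⊓ LinearMap.ker φ) = Module.finrank ℝ (V ⧸ W) + 1 := by
  have hker : LinearMap.ker (W.mkQ.prod φ) = W ⊓ LinearMap.ker φ := by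
    rw [LinearMap.ker_prod, Submodule.ker_mkQ]
  have hsurj : Function.Surjective (W.mkQ.prod φ) := by
    rintro ⟨q, t⟩
    obtain ⟨v, rfl⟩ := W.mkQ_surjective q
    -- Moving along `e ∈ W` adjusts `φ` freely without changing the class modulo `W`.
    refine ⟨v + ((t - φ v) / φ e) • e, Prod.ext ?_ ?_⟩
    · simp [(Submodule.Quotient.mk_eq_zero W).2 he]
    · simp [div_mul_cancel₀ _ hφ]
  rw [← hker, ((W.mkQ.prod φ).quotKerEquivOfSurjective hsurj).finrank_eq, Module.finrank_prod,
    Module.finrank_self]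

namespace HypArrangement

variable {V : Type*} [AddCommGroup V] [Module ℝ V] {I : Type*} {A : HypArrangement V I}

noncomputable instance [Finite I] : Fintype A.Face := Fintype.ofFinite _

noncomputable instance [Finite I] : Fintype A.Flat := Fintype.ofFinite _

theorem Face.mul_sgn [Finite I] (F G : A.Face) (i : I) :
    (F * G).sgn i = if F.sgn i ≠ 0 then F.sgn i else G.sgn i := rfl

theorem form_sub (A : HypArrangement V I) (i : I) (v w : V) :
    A.form i v - A.form i w = (A.form i).linear (v - w) := by
  simpa using ((A.form i).linearMap_vsub v w).symm

theorem form_add (A : HypArrangement V I) (i : I) (v w : V) :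
    A.form i (v + w) = A.form i v + (A.form i).linear w := by
  have := A.form_sub i (v + w) v
  rw [add_sub_cancel_left] at this
  linarith

/-- The common direction of the hyperplanes with index in `Z`. -/
def direction (A : HypArrangement V I) (Z : Set I) : Submodule ℝ V :=
  ⨅ i ∈ Z, LinearMap.ker (A.form i).linear

theorem mem_direction {Z : Set I} {v : V} :
    v ∈ A.direction Z ↔ ∀ i ∈ Z, (A.form i).linear v = 0 := by
  simp [direction]

theorem direction_insert (Z : Set I) (i : I) :
    A.direction (insert i Z) = A.direction Z ⊓ LinearMap.ker (A.form i).linear := by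
  ext v
  simp [mem_direction, and_comm]

/-- The codimension of `direction A Z`. -/
noncomputable def codim (A : HypArrangement V I) (Z : Set I) : ℕ :=
  Module.finrank ℝ (V ⧸ A.direction Z)

/-- `V` may be infinite-dimensional; the quotient is the range of finitely many functionals. -/
instance finiteDimensional_quotient_direction [Finite I] (Z : Set I) :
    FiniteDimensional ℝ (V ⧸ A.direction Z) := by
  have h : A.direction Z = LinearMap.ker (LinearMap.pi fun i : Z => (A.form i).linear) := by
    ext v
    simp [mem_direction, funext_iff]
  rw [h]
  exact Module.Finite.equiv (LinearMap.quotKerEquivRange _).symm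

theorem codim_empty : A.codim ∅ = 0 := by
  have h : A.direction ∅ = ⊤ := by simp [direction]
  have := Submodule.Quotient.subsingleton_iff.2 h
  exact Module.finrank_zero_of_subsingleton

theorem codim_insert_of_mem_direction [Finite I] {Z : Set I} {i : I} {e : V}
    (he : e ∈ A.direction Z) (hi : (A.form i).linear e ≠ 0) :
    A.codim (insert i Z) = A.codim Z + 1 := by
  rw [codim, direction_insert, finrank_quotient_inf_ker _ _ he hi, codim]

theorem codim_insert_of_forall {Z : Set I} {i : I}
    (h : ∀ e ∈ A.direction Z, (A.form i).linear e = 0) :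
    A.codim (insert i Z) = A.codim Z := by
  rw [codim, direction_insert, inf_eq_left.2 (fun e he => h e he), codim]

theorem openRegion_insert_update [DecidableEq I] {K : Set I} {τ : I → SignType} {i : I} (hi : i ∉ K)
    (s : SignType) :
    A.openRegion (insert i K) (Function.update τ i s)
      = A.openRegion K τ ∩ {v | SignType.sign (A.form i v) = s} := by
  ext v
  simp only [openRegion, Set.forall_mem_insert, Set.mem_ofPred_eq, Function.update_self,
    Set.mem_inter_iff]
  rw [and_comm]
  refine and_congr_left fun _ => forall₂_congr fun k hk => ?_
  rw [Function.update_of_ne (by rintro rfl; exact hi hk)]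

theorem exists_mem_openRegion_form_eq_zero {K : Set I} {τ : I → SignType} {i : I} {v w : V}
    (hv : v ∈ A.openRegion K τ) (hw : w ∈ A.openRegion K τ)
    (hiv : A.form i v < 0) (hiw : 0 < A.form i w) :
    ∃ u ∈ A.openRegion K τ, A.form i u = 0 := by
  have hval : ∀ k (t : ℝ), A.form k (AffineMap.lineMap v w t)
      = (1 - t) * A.form k v + t * A.form k w := by
    intro k t
    rw [AffineMap.apply_lineMap, AffineMap.lineMap_apply]
    simp only [vsub_eq_sub, smul_eq_mul, vadd_eq_add]
    ring
  -- The parameter at which the segment from `v` to `w` crosses the hyperplane; the cell is convex.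
  set t := A.form i v / (A.form i v - A.form i w) with ht
  have hlt : A.form i v - A.form i w < 0 := by linarith
  have ht0 : 0 < t := div_pos_of_neg_of_neg hiv hlt
  have ht1 : 0 < 1 - t := by
    rw [ht, one_sub_div hlt.ne]
    exact div_pos_of_neg_of_neg (by linarith) hlt
  refine ⟨AffineMap.lineMap v w t, fun k hk => ?_, ?_⟩
  · have h1 := hv k hk
    have h2 := hw k hk
    rw [hval, ← h1]
    rw [← h1] at h2
    rcases lt_trichotomy (A.form k v) 0 with h | h | h
    · rw [sign_neg h, sign_eq_neg_one_iff] at h2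
      rw [sign_neg h, sign_eq_neg_one_iff]
      nlinarith
    · rw [h, sign_zero, sign_eq_zero_iff] at h2
      simp [h, h2]
    · rw [sign_pos h, sign_eq_one_iff] at h2
      rw [sign_pos h, sign_eq_one_iff]
      positivity
  · have hne := hlt.ne
    rw [hval, ht]
    field_simp
    ring

/-- A small step from `v` towards `v + e` keeps the nonzero signs at `v`; on hyperplanes through `v`
the sign becomes that of the linear part at `e`. -/
theorem exists_mem_openRegion_of_mem_direction [Finite I] {K : Set I} {τ : I → SignType} {i : I}
    {v e : V} (hv : v ∈ A.openRegion K τ) (hiv : A.form i v = 0)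
    (he : e ∈ A.direction {k ∈ K | τ k = 0}) :
    ∃ u ∈ A.openRegion K τ, SignType.sign (A.form i u) = SignType.sign ((A.form i).linear e) := by
  obtain ⟨u, hu⟩ := A.exists_signSeq_eq_mul v (v + e)
  have hu' := fun k => congrFun hu k
  simp only [signSeq, form_add] at hu'
  refine ⟨u, fun k hk => ?_, by rw [hu' i]; simp [hiv]⟩
  rw [hu' k, hv k hk]
  split_ifs with h
  · rfl
  · push Not at h
    have h1 := hv k hk
    rw [h, sign_eq_zero_iff] at h1
    rw [h1, mem_direction.1 he k ⟨hk, h⟩, h]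
    simp

open scoped Classical in
/-- The Euler relation for the faces in a relatively open cell. -/
theorem sum_neg_one_pow_codim [Finite I] (K : Set I) (τ : I → SignType)
    (hne : (A.openRegion K τ).Nonempty) :
    ∑ F : A.Face with ∀ i ∈ K, F.sgn i = τ i, (-1 : ℤ) ^ A.codim {i | F.sgn i = 0}
      = (-1) ^ A.codim {i ∈ K | τ i = 0} := by
  -- Induction on the number of unconstrained hyperplanes: cut the cell by one of them and add the
  -- relations for its pieces.
  induction hn : Kᶜ.ncard generalizing K τ with
  | zero =>
    rw [Set.ncard_eq_zero, Set.compl_empty_iff] at hn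
    subst hn
    obtain ⟨v, hv⟩ := hne
    have : (Finset.univ.filter fun F : A.Face => ∀ i ∈ Set.univ, F.sgn i = τ i) =
        {⟨τ, v, funext fun i => hv i trivial⟩} := by
      ext F
      simp [Face.ext_iff, funext_iff]
    rw [this]
    simp
  | succ n ih =>
    have hKc : Kᶜ.Nonempty := by
      rw [Set.nonempty_iff_ne_empty]
      rintro h
      simp [h] at hn
    obtain ⟨i, hi : i ∉ K⟩ := hKc
    have hn' : (insert i K)ᶜ.ncard = n := by
      have h1 : (insert i K)ᶜ = Kᶜ \ {i} := by
        ext k; simp [and_comm]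
      rw [h1, Set.ncard_sdiff_singleton_of_mem hi, hn, Nat.add_sub_cancel]
    let g : SignType → ℤ := fun s =>
      ∑ F : A.Face with (∀ k ∈ insert i K, F.sgn k = Function.update τ i s k),
        (-1 : ℤ) ^ A.codim {k | F.sgn k = 0}
    have hset : ∀ s, {k ∈ insert i K | Function.update τ i s k = 0}
        = if s = 0 then insert i {k ∈ K | τ k = 0} else {k ∈ K | τ k = 0} := by
      intro s
      ext k
      by_cases hk : k = i
      · subst hk
        by_cases hs : s = 0 <;> simp [hs, hi]
      · by_cases hs : s = 0 <;> simp [hs, hk]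
    have hg : ∀ s, (A.openRegion K τ ∩ {v | SignType.sign (A.form i v) = s}).Nonempty →
        g s = (-1) ^ A.codim (if s = 0 then insert i {k ∈ K | τ k = 0} else {k ∈ K | τ k = 0}) := by
      intro s hs
      rw [← hset, ← ih _ _ (by rwa [openRegion_insert_update hi]) hn']
    have hg0 : ∀ s, (∀ v ∈ A.openRegion K τ, SignType.sign (A.form i v) ≠ s) → g s = 0 := by
      intro s hs
      refine Finset.sum_eq_zero fun F hF => ?_
      obtain ⟨v, hv⟩ := F.realized
      have hv' : v ∈ A.openRegion (insert i K) (Function.update τ i s) := by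
        intro k hk
        rw [← (Finset.mem_filter.1 hF).2 k hk, ← hv, signSeq]
      rw [openRegion_insert_update hi] at hv'
      exact absurd hv'.2 (hs v hv'.1)
    have hsum : ∑ F : A.Face with ∀ i ∈ K, F.sgn i = τ i, (-1 : ℤ) ^ A.codim {i | F.sgn i = 0}
        = ∑ s, g s := by
      rw [← Finset.sum_fiberwise _ (fun F : A.Face => F.sgn i)]
      refine Finset.sum_congr rfl fun s _ => ?_
      rw [Finset.filter_filter]
      refine Finset.sum_congr (Finset.filter_congr fun F _ => ?_) fun _ _ => rfl
      rw [Set.forall_mem_insert, Function.update_self, and_comm]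
      refine and_congr_right fun _ => forall₂_congr fun k hk => ?_
      rw [Function.update_of_ne (by rintro rfl; exact hi hk)]
    rw [hsum]
    by_cases h0 : ∃ v ∈ A.openRegion K τ, A.form i v = 0
    · obtain ⟨v, hv, hiv⟩ := h0
      have hv0 : g 0 = _ := hg 0 ⟨v, hv, by simp [hiv]⟩
      rw [if_pos rfl] at hv0
      -- If the hyperplane cuts the cell properly, two pieces have codimension `c` and one has `c +
      -- 1`: `2(-1)^c + (-1)^(c+1) = (-1)^c`. Otherwise the cell lies inside the hyperplane.
      by_cases he : ∃ e ∈ A.direction {k ∈ K | τ k = 0}, (A.form i).linear e ≠ 0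
      · obtain ⟨e, he, hie⟩ := he
        have hs : ∀ s : SignType, s ≠ 0 → g s = (-1) ^ A.codim {k ∈ K | τ k = 0} := by
          intro s hs
          obtain ⟨c, hc⟩ : ∃ c : ℝ, SignType.sign c = s := ⟨s, by cases s <;> simp⟩
          obtain ⟨u, hu, hiu⟩ := exists_mem_openRegion_of_mem_direction (i := i) hv hiv
            (Submodule.smul_mem _ (c / (A.form i).linear e) he)
          rw [map_smul, smul_eq_mul, div_mul_cancel₀ _ hie, hc] at hiu
          rw [hg s ⟨u, hu, hiu⟩, if_neg hs]
        rw [codim_insert_of_mem_direction he hie] at hv0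
        rw [SignType.univ_eq]
        simp [hv0, hs, pow_succ]
      · push Not at he
        rw [codim_insert_of_forall he] at hv0
        rw [← hv0]
        refine Finset.sum_eq_single _ (fun s _ hs => hg0 s fun u hu => ?_) (by simp)
        have hd : u - v ∈ A.direction {k ∈ K | τ k = 0} := by
          refine mem_direction.2 fun k hk => ?_
          have h1 := hu k hk.1
          have h2 := hv k hk.1
          rw [hk.2, sign_eq_zero_iff] at h1 h2
          rw [← form_sub, h1, h2, sub_zero]
        have h3 := he _ hd
        rw [← form_sub, hiv, sub_zero] at h3
        rw [h3, sign_zero]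
        exact hs.symm
    -- The cell misses the hyperplane, so by convexity it lies on one side.
    · push Not at h0
      obtain ⟨v, hv⟩ := hne
      have hv0 : g _ = _ := hg _ ⟨v, hv, rfl⟩
      rw [if_neg (by simpa using h0 v hv)] at hv0
      rw [← hv0]
      refine Finset.sum_eq_single _ (fun s _ hs => hg0 s ?_) (by simp)
      rintro u hu rfl
      rcases (h0 v hv).lt_or_gt with h1 | h1 <;> rcases (h0 u hu).lt_or_gt with h2 | h2
      · simp [sign_neg h1, sign_neg h2] at hs
      · obtain ⟨x, hx, hx0⟩ := exists_mem_openRegion_form_eq_zero hv hu h1 h2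
        exact h0 x hx hx0
      · obtain ⟨x, hx, hx0⟩ := exists_mem_openRegion_form_eq_zero hu hv h2 h1
        exact h0 x hx hx0
      · simp [sign_pos h1, sign_pos h2] at hs

end HypArrangement

/-! ### Möbius numbers of flats and Zaslavsky's formula. -/

namespace HypArrangement

variable {V : Type*} [AddCommGroup V] [Module ℝ V] {I : Type*} {A : HypArrangement V I}

/-- The indices of the hyperplanes containing a flat. -/
def Flat.zeros (X : A.Flat) : Set I := {i | X.1 ⊆ A.hyperplane i}

theorem Flat.eq_iInter_zeros (X : A.Flat) : X.1 = ⋂ i ∈ X.zeros, A.hyperplane i := by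
  refine subset_antisymm (Set.subset_iInter₂ fun i hi => hi) ?_
  obtain ⟨T, hT⟩ := X.2.2
  conv_rhs => rw [hT]
  refine Set.biInter_subset_biInter_left fun i hi => ?_
  change X.1 ⊆ _
  rw [hT]
  exact Set.biInter_subset_of_mem hi

theorem Flat.mem_iff {X : A.Flat} {v : V} : v ∈ X.1 ↔ ∀ i ∈ X.zeros, A.form i v = 0 := by
  rw [X.eq_iInter_zeros]
  simp only [Set.mem_iInter]
  rfl

theorem Flat.le_iff {X Y : A.Flat} : X ≤ Y ↔ X.1 ⊆ Y.1 := Iff.rfl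

theorem Flat.le_whole (X : A.Flat) : X ≤ Flat.whole A := Set.subset_univ X.1

theorem Flat.zeros_whole : (Flat.whole A).zeros = ∅ := by
  refine Set.eq_empty_of_forall_notMem fun i hi => A.nonconst i (LinearMap.ext fun v => ?_)
  have h : ∀ v, A.form i v = 0 := fun v => hi (Set.mem_univ v)
  rw [← add_sub_cancel_left 0 v, ← form_sub, h, h]
  simp

open scoped Classical in
theorem sum_mu_whole [Finite I] (Z : A.Flat) :
    (∑ Y : A.Flat with Z ≤ Y, IncidenceAlgebra.mu ℤ Y (Flat.whole A))
      = if Z = Flat.whole A then 1 else 0 := by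
  rw [← IncidenceAlgebra.sum_Icc_mu_left]
  refine Finset.sum_congr ?_ fun _ _ => rfl
  ext Y
  simp [Flat.le_whole]

open scoped Classical in
/-- Weisner's theorem for the lattice of flats and the coatom `H i`. -/
theorem sum_mu_inter_eq_zero [Finite I] (i : I) (Z : A.Flat) (hZ : Z.1 ⊆ A.hyperplane i) :
    (∑ Y : A.Flat with Y.1 ∩ A.hyperplane i = Z.1,
      IncidenceAlgebra.mu ℤ Y (Flat.whole A)) = 0 := by
  induction Z using WellFoundedGT.induction with
  | ind Z ih =>
    have hne : Z ≠ Flat.whole A := by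
      rintro rfl
      have : i ∈ (Flat.whole A).zeros := hZ
      simp [Flat.zeros_whole] at this
    have h := sum_mu_whole Z
    rw [if_neg hne] at h
    -- Group the flats above `Z` by their intersection with the hyperplane; all groups but that of
    -- `Z` vanish by induction.
    have key : (∑ Y : A.Flat with Z ≤ Y, IncidenceAlgebra.mu ℤ Y (Flat.whole A))
        = ∑ Z' : A.Flat with Z ≤ Z' ∧ Z'.1 ⊆ A.hyperplane i,
          ∑ Y : A.Flat with Y.1 ∩ A.hyperplane i = Z'.1,
            IncidenceAlgebra.mu ℤ Y (Flat.whole A) := by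
      simp only [Finset.sum_filter (fun Y : A.Flat => Y.1 ∩ A.hyperplane i = _)]
      rw [Finset.sum_comm, Finset.sum_filter]
      refine Finset.sum_congr rfl fun Y _ => ?_
      split_ifs with hY
      · have hsub : Z.1 ⊆ Y.1 ∩ A.hyperplane i := Set.subset_inter hY hZ
        let Z' : A.Flat := ⟨Y.1 ∩ A.hyperplane i, Z.2.1.mono hsub, insert i Y.zeros, by
          rw [Set.biInter_insert, ← Y.eq_iInter_zeros, Set.inter_comm]⟩
        rw [Finset.sum_eq_single Z' (fun W _ hW => if_neg fun h => hW (Subtype.ext h.symm)) ?_]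
        · rw [if_pos rfl]
        · intro h
          exact absurd (Finset.mem_filter.2 ⟨Finset.mem_univ _, hsub, Set.inter_subset_right⟩) h
      · refine (Finset.sum_eq_zero fun W hW => if_neg fun h => hY ?_).symm
        exact Flat.le_iff.2 ((Flat.le_iff.1 (Finset.mem_filter.1 hW).2.1).trans
          (h.ge.trans Set.inter_subset_left))
    rw [key, Finset.sum_eq_single Z] at h
    · exact h
    · intro W hW hWZ
      obtain ⟨-, h1, h2⟩ := Finset.mem_filter.1 hW
      exact ih W (lt_of_le_of_ne h1 hWZ.symm) h2
    · intro h
      exact absurd (Finset.mem_filter.2 ⟨Finset.mem_univ _, le_rfl, hZ⟩) h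

theorem codim_zeros_of_inter_eq [Finite I] {X Y : A.Flat} {i : I}
    (h : Y.1 ∩ A.hyperplane i = X.1) (hne : Y ≠ X) :
    A.codim X.zeros = A.codim Y.zeros + 1 := by
  obtain ⟨x, hx⟩ := X.2.1
  have hx' := hx
  rw [← h] at hx'
  obtain ⟨y, hy, hyi⟩ : ∃ y ∈ Y.1, A.form i y ≠ 0 := by
    by_contra! hc
    have hYi : Y.1 ⊆ A.hyperplane i := hc
    exact hne (Subtype.ext (by rw [← h, Set.inter_eq_left.2 hYi]))
  have he : y - x ∈ A.direction Y.zeros := by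
    refine mem_direction.2 fun k hk => ?_
    rw [← form_sub, Flat.mem_iff.1 hy k hk, Flat.mem_iff.1 hx'.1 k hk, sub_zero]
  have hi : (A.form i).linear (y - x) ≠ 0 := by
    rw [← form_sub, show A.form i x = 0 from hx'.2, sub_zero]
    exact hyi
  rw [← codim_insert_of_mem_direction he hi, codim, codim]
  -- `X.zeros` may exceed `insert i Y.zeros`, but translating `x ∈ X` by a vector of the right-hand
  -- direction stays in `X`.
  have hdir : A.direction X.zeros = A.direction (insert i Y.zeros) := by
    ext v
    simp only [mem_direction]
    constructor
    · intro hv k hk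
      refine hv k ?_
      change X.1 ⊆ _
      rw [← h]
      rcases hk with rfl | hk
      · exact Set.inter_subset_right
      · exact Set.inter_subset_left.trans hk
    · intro hv k hk
      have hxv : x + v ∈ X.1 := by
        rw [← h]
        refine ⟨Flat.mem_iff.2 fun j hj => ?_, ?_⟩
        · rw [form_add, hv j (Or.inr hj), Flat.mem_iff.1 hx'.1 j hj, add_zero]
        · change A.form i (x + v) = 0
          rw [form_add, hv i (Or.inl rfl), show A.form i x = 0 from hx'.2, add_zero]
      have h1 := form_add A k x v
      rw [Flat.mem_iff.1 hx k hk, Flat.mem_iff.1 hxv k hk, zero_add] at h1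
      exact h1.symm
  rw [hdir]

theorem exists_inter_hyperplane_eq [Finite I] {X : A.Flat} (hX : X ≠ Flat.whole A) :
    ∃ (i : I) (Y : A.Flat), Y.1 ∩ A.hyperplane i = X.1 ∧ Y ≠ X := by
  -- With a minimal defining set of indices, dropping any index strictly enlarges the intersection.
  obtain ⟨T, hT⟩ := (Set.toFinite {T : Set I | X.1 = ⋂ i ∈ T, A.hyperplane i}).exists_minimal X.2.2
  have hXT : X.1 = ⋂ i ∈ T, A.hyperplane i := hT.1
  obtain ⟨i, hi⟩ : T.Nonempty := by
    rw [Set.nonempty_iff_ne_empty]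
    rintro rfl
    exact hX (Subtype.ext (by rw [hXT]; simp [Flat.whole]))
  have hinter : (⋂ j ∈ T \ {i}, A.hyperplane j) ∩ A.hyperplane i = X.1 := by
    rw [hXT, Set.inter_comm, ← Set.biInter_insert, Set.insert_sdiff_singleton,
      Set.insert_eq_of_mem hi]
  refine ⟨i, ⟨⋂ j ∈ T \ {i}, A.hyperplane j,
    X.2.1.mono (hinter ▸ Set.inter_subset_left), _, rfl⟩, hinter, fun hc => ?_⟩
  have h1 := hT.2 (y := T \ {i}) (congrArg Subtype.val hc).symm Set.sdiff_subset
  exact (h1 hi).2 rfl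

/-- The Möbius numbers `μ(X, V)` are nonzero and alternate in sign. -/
theorem neg_one_pow_codim_mul_mu_pos [Finite I] (X : A.Flat) :
    0 < (-1 : ℤ) ^ A.codim X.zeros * IncidenceAlgebra.mu ℤ X (Flat.whole A) := by
  classical
  induction X using WellFoundedGT.induction with
  | ind X ih =>
    by_cases hX : X = Flat.whole A
    · subst hX
      simp [Flat.zeros_whole, codim_empty]
    obtain ⟨i, Y, hY, hYX⟩ := exists_inter_hyperplane_eq hX
    have hXi : X.1 ⊆ A.hyperplane i := hY ▸ Set.inter_subset_right
    have h := sum_mu_inter_eq_zero i X hXi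
    rw [← Finset.add_sum_erase _ _ (Finset.mem_filter.2
      ⟨Finset.mem_univ X, Set.inter_eq_left.2 hXi⟩)] at h
    -- Weisner's relation expresses `μ(X,V)` as minus a sum over flats of codimension one less; `Y`
    -- makes that sum nonempty.
    rw [eq_neg_of_add_eq_zero_left h, mul_neg, Finset.mul_sum, ← Finset.sum_neg_distrib]
    refine Finset.sum_pos (fun Z hZ => ?_) ⟨Y, by simp [hY, hYX]⟩
    rw [Finset.mem_erase, Finset.mem_filter] at hZ
    obtain ⟨hZX, -, hZ⟩ := hZ
    have hlt : X < Z :=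
      lt_of_le_of_ne (Flat.le_iff.2 (hZ ▸ Set.inter_subset_left)) hZX.symm
    rw [codim_zeros_of_inter_eq hZ hZX, pow_succ]
    simpa using ih Z hlt

theorem absMobius_eq [Finite I] (X : A.Flat) :
    (absMobius X : ℤ) = (-1) ^ A.codim X.zeros * IncidenceAlgebra.mu ℤ X (Flat.whole A) := by
  rw [← abs_of_pos (neg_one_pow_codim_mul_mu_pos X), abs_mul, abs_pow, abs_neg, abs_one, one_pow,
    one_mul, absMobius, Int.natCast_natAbs]

theorem absMobius_ne_zero [Finite I] (X : A.Flat) : absMobius X ≠ 0 := by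
  have h := neg_one_pow_codim_mul_mu_pos X
  rw [← absMobius_eq] at h
  exact_mod_cast h.ne'

/-- The indices of the hyperplanes containing a face. -/
def Face.zeros (F : A.Face) : Set I := {i | F.sgn i = 0}

/-- The smallest flat containing a face. -/
def Face.support (F : A.Face) : A.Flat :=
  ⟨⋂ i ∈ F.zeros, A.hyperplane i, by
    obtain ⟨v, hv⟩ := F.realized
    refine ⟨v, Set.mem_iInter₂.2 fun i hi => ?_⟩
    have h1 : SignType.sign (A.form i v) = 0 := (congrFun hv i).trans hi
    exact sign_eq_zero_iff.1 h1, F.zeros, rfl⟩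

theorem Face.carrier_nonempty (F : A.Face) : F.carrier.Nonempty := by
  obtain ⟨v, hv⟩ := F.realized
  exact ⟨v, fun i => congrFun hv i⟩

theorem Face.carrier_subset_support (F : A.Face) : F.carrier ⊆ F.support.1 := by
  refine fun v hv => Set.mem_iInter₂.2 fun i hi => ?_
  have h1 : SignType.sign (A.form i v) = 0 := (hv i).trans hi
  exact sign_eq_zero_iff.1 h1

theorem Face.carrier_subset_iff {F : A.Face} {X : A.Flat} :
    F.carrier ⊆ X.1 ↔ X.zeros ⊆ F.zeros := by
  constructor
  · intro h i hi
    obtain ⟨v, hv⟩ := F.carrier_nonempty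
    change F.sgn i = 0
    rw [← hv i, Flat.mem_iff.1 (h hv) i hi, sign_zero]
  · intro h v hv
    refine Flat.mem_iff.2 fun i hi => ?_
    have h1 : SignType.sign (A.form i v) = 0 := (hv i).trans (h hi)
    exact sign_eq_zero_iff.1 h1

theorem Face.support_le_iff {F : A.Face} {X : A.Flat} :
    F.support ≤ X ↔ X.zeros ⊆ F.zeros := by
  rw [Flat.le_iff]
  refine ⟨fun h => Face.carrier_subset_iff.1 (F.carrier_subset_support.trans h), fun h => ?_⟩
  rw [X.eq_iInter_zeros]
  exact Set.biInter_subset_biInter_left h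

theorem Face.support_eq_whole_iff {F : A.Face} : F.support = Flat.whole A ↔ F.IsChamber := by
  rw [← (Flat.le_whole F.support).ge_iff_eq]
  constructor
  · intro h i hi
    have h1 : F.support.zeros ⊆ (Flat.whole A).zeros :=
      fun j hj => (Flat.le_iff.1 h).trans hj
    have h2 : i ∈ F.support.zeros := fun v hv => Set.mem_iInter₂.1 hv i hi
    simpa [Flat.zeros_whole] using h1 h2
  · intro h
    have h1 : F.zeros = ∅ := Set.eq_empty_of_forall_notMem fun i hi => h i hi
    rw [Flat.le_iff, (Face.support F).eq_iInter_zeros]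
    refine Set.subset_iInter₂ fun i hi => ?_
    have h2 : (Flat.whole A).1 = F.support.1 := by simp [Flat.whole, Face.support, h1]
    rw [h2]
    exact hi

-- When nonempty, `X ∩ U` is a relatively open cell whose vanishing indices are exactly `X.zeros`,
-- since the signs on `J` are nonzero; the Euler relation applies to it.
open scoped Classical in
theorem sum_neg_one_pow_codim_of_zeros_subset [Finite I] {J : Set I} {σ : I → SignType}
    (hσ : ∀ i ∈ J, σ i ≠ 0) (X : A.Flat) :
    (∑ F : A.Face with (∀ i ∈ J, F.sgn i = σ i) ∧ X.zeros ⊆ F.zeros,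
      (-1 : ℤ) ^ A.codim F.zeros)
      = if X ∈ A.flatsMeeting (A.openRegion J σ) then (-1) ^ A.codim X.zeros else 0 := by
  split_ifs with hX
  · obtain ⟨v, hvX, hvU⟩ := hX
    have hdisj : ∀ i ∈ J, i ∉ X.zeros := fun i hi hi' => hσ i hi (by
      rw [← hvU i hi, Flat.mem_iff.1 hvX i hi', sign_zero])
    let τ : I → SignType := fun i => if i ∈ X.zeros then 0 else σ i
    have h := sum_neg_one_pow_codim (A := A) (J ∪ X.zeros) τ ⟨v, ?_⟩
    · have hz : {i ∈ J ∪ X.zeros | τ i = 0} = X.zeros := by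
        ext i
        by_cases hi : i ∈ X.zeros
        · simp [τ, hi]
        · simp only [τ, hi, Set.mem_union, or_false, if_false, iff_false, Set.mem_ofPred_eq]
          exact fun h => hσ i h.1 h.2
      rw [hz] at h
      rw [← h]
      refine Finset.sum_congr (Finset.filter_congr fun F _ => ?_) fun _ _ => rfl
      constructor
      · rintro ⟨h1, h2⟩ i (hi | hi)
        · simp [τ, hdisj i hi, h1 i hi]
        · exact (show F.sgn i = 0 from h2 hi).trans (if_pos hi).symm
      · intro h
        refine ⟨fun i hi => ?_, fun i hi => ?_⟩
        · simpa [τ, hdisj i hi] using h i (Or.inl hi)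
        · exact (h i (Or.inr hi)).trans (if_pos hi)
    · rintro i (hi | hi)
      · simp [τ, hdisj i hi, hvU i hi]
      · simp [τ, hi, Flat.mem_iff.1 hvX i hi]
  · refine Finset.sum_eq_zero fun F hF => absurd ?_ hX
    obtain ⟨-, h1, h2⟩ := Finset.mem_filter.1 hF
    obtain ⟨v, hv⟩ := F.carrier_nonempty
    exact ⟨v, Face.carrier_subset_iff.2 h2 hv, fun i hi => (hv i).trans (h1 i hi)⟩

/-- Zaslavsky's theorem for convex sets of chambers. -/
theorem card_chambersIn [Finite I] {J : Set I} {σ : I → SignType} (hσ : ∀ i ∈ J, σ i ≠ 0) :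
    Fintype.card (A.chambersIn J σ)
      = ∑ X : A.flatsMeeting (A.openRegion J σ), absMobius (X : A.Flat) := by
  classical
  -- Double count of `(-1)^codim(F) μ(X,V)` over pairs `F ⊆ X ∩ U`. Summing over `F` first gives
  -- `|μ(X,V)|`; summing over `X ≥ supp F` first leaves only chambers.
  have h1 : ((∑ X : A.flatsMeeting (A.openRegion J σ), absMobius (X : A.Flat) : ℕ) : ℤ)
      = ∑ X : A.Flat, ∑ F : A.Face,
        if (∀ i ∈ J, F.sgn i = σ i) ∧ X.zeros ⊆ F.zeros then
          (-1 : ℤ) ^ A.codim F.zeros * IncidenceAlgebra.mu ℤ X (Flat.whole A) else 0 := by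
    have h2 : ∀ X : A.Flat, (∑ F : A.Face,
        if (∀ i ∈ J, F.sgn i = σ i) ∧ X.zeros ⊆ F.zeros then
          (-1 : ℤ) ^ A.codim F.zeros * IncidenceAlgebra.mu ℤ X (Flat.whole A) else 0)
        = if X ∈ A.flatsMeeting (A.openRegion J σ) then (absMobius X : ℤ) else 0 := by
      intro X
      rw [← Finset.sum_filter, ← Finset.sum_mul, sum_neg_one_pow_codim_of_zeros_subset hσ,
        ite_mul, zero_mul, absMobius_eq]
    simp only [h2]
    rw [Nat.cast_sum, ← Finset.sum_filter]
    exact (Finset.sum_subtype (Finset.univ.filter (· ∈ A.flatsMeeting (A.openRegion J σ)))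
      (fun X => Finset.mem_filter_univ X) fun X => (absMobius X : ℤ)).symm
  have h2 : (Fintype.card (A.chambersIn J σ) : ℤ) = ∑ F : A.Face, ∑ X : A.Flat,
        if (∀ i ∈ J, F.sgn i = σ i) ∧ X.zeros ⊆ F.zeros then
          (-1 : ℤ) ^ A.codim F.zeros * IncidenceAlgebra.mu ℤ X (Flat.whole A) else 0 := by
    have h3 : ∀ F : A.Face, (∑ X : A.Flat,
        if (∀ i ∈ J, F.sgn i = σ i) ∧ X.zeros ⊆ F.zeros then
          (-1 : ℤ) ^ A.codim F.zeros * IncidenceAlgebra.mu ℤ X (Flat.whole A) else 0)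
        = if F ∈ A.chambersIn J σ then 1 else 0 := by
      intro F
      by_cases hF : ∀ i ∈ J, F.sgn i = σ i
      · simp only [and_iff_right hF, ← Face.support_le_iff]
        rw [← Finset.sum_filter, ← Finset.mul_sum, sum_mu_whole]
        simp only [Face.support_eq_whole_iff]
        by_cases hc : F.IsChamber
        · have h4 : F.zeros = ∅ := Set.eq_empty_of_forall_notMem fun i hi => hc i hi
          rw [if_pos hc, if_pos ⟨hc, hF⟩, h4, codim_empty]
          rfl
        · rw [if_neg hc, if_neg fun h => hc h.1, mul_zero]
      · rw [if_neg fun h => hF h.2]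
        simp [hF]
    simp only [h3]
    rw [Finset.sum_boole, Fintype.card_subtype]
  have h3 := h2.trans (Finset.sum_comm.trans h1.symm)
  exact_mod_cast h3

end HypArrangement

/-! ### Face products and diagonalizability. -/

namespace HypArrangement

variable {V : Type*} [AddCommGroup V] [Module ℝ V] {I : Type*} {A : HypArrangement V I}

theorem mul_mem_chambersIn [Finite I] {J : Set I} {σ : I → SignType} {G C : A.Face}
    (hG : G ∈ facesOf (A.chambersIn J σ)) (hC : C ∈ A.chambersIn J σ) :
    G * C ∈ A.chambersIn J σ := by
  obtain ⟨C', hC', hGC⟩ := hG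
  refine ⟨fun i => ?_, fun i hi => ?_⟩ <;> rw [Face.mul_sgn] <;> split_ifs with h
  · exact h
  · exact hC.1 i
  · rw [(hGC i).resolve_left h, hC'.2 i hi]
  · exact hC.2 i hi

theorem mul_mem_facesOf [Finite I] {J : Set I} {σ : I → SignType} {F G : A.Face}
    (hF : F ∈ facesOf (A.chambersIn J σ)) (hG : G ∈ facesOf (A.chambersIn J σ)) :
    F * G ∈ facesOf (A.chambersIn J σ) := by
  obtain ⟨C, hC, hGC⟩ := hG
  refine ⟨F * C, mul_mem_chambersIn hF hC, fun i => ?_⟩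
  rw [Face.mul_sgn, Face.mul_sgn]
  split_ifs with h
  · exact Or.inr rfl
  · exact hGC i

theorem Face.mul_assoc' [Finite I] (F G H : A.Face) : F * G * H = F * (G * H) := by
  ext i
  simp only [Face.mul_sgn]
  split_ifs <;> simp_all

theorem Face.zeros_mul [Finite I] (F G : A.Face) : (F * G).zeros = F.zeros ∩ G.zeros := by
  ext i
  by_cases h : F.sgn i = 0 <;> simp [Face.zeros, Face.mul_sgn, h]

theorem Face.mul_eq_left [Finite I] {F G : A.Face} (h : F.zeros ⊆ G.zeros) : F * G = F := by
  ext i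
  rw [Face.mul_sgn]
  split_ifs with hi
  · rfl
  · push Not at hi
    rw [hi]
    exact h hi

/-- The matrix of left multiplication by a face on the chambers of `D`. -/
noncomputable def mulMatrix [Finite I] (D : Set A.Face) (G : A.Face) : Matrix D D ℝ :=
  fun C C' => if G * (C : A.Face) = C' then 1 else 0

theorem transition_eq_sum [Finite I] (D : Set A.Face) (w : facesOf D → ℝ) :
    transition D w = ∑ G, w G • mulMatrix D G := by
  ext C C'
  simp [transition, mulMatrix, Matrix.sum_apply]

/-- The order reverses because rows index the starting chamber: `G` acts first, then `F`. -/
theorem mulMatrix_mul [Finite I] {J : Set I} {σ : I → SignType} (F : A.Face) {G : A.Face}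
    (hG : G ∈ facesOf (A.chambersIn J σ)) :
    mulMatrix (A.chambersIn J σ) G * mulMatrix (A.chambersIn J σ) F
      = mulMatrix (A.chambersIn J σ) (F * G) := by
  ext C C'
  rw [Matrix.mul_apply, Finset.sum_eq_single ⟨G * C, mul_mem_chambersIn hG C.2⟩]
  · simp [mulMatrix, Face.mul_assoc']
  · intro C'' _ h
    have h1 : G * (C : A.Face) ≠ C'' := fun hc => h (Subtype.ext hc.symm)
    simp [mulMatrix, h1]
  · simp

section Diagonalizable

variable [Finite I] {J : Set I} {σ : I → SignType} (w : facesOf (A.chambersIn J σ) → ℝ)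

open scoped Classical in
/-- The total weight of the faces contained in the support of `F`. -/
noncomputable def supportWeight (F : A.Face) : ℝ :=
  ∑ G : facesOf (A.chambersIn J σ), if F.zeros ⊆ (G : A.Face).zeros then w G else 0

variable {w}

theorem weight_le_supportWeight (hw : ∀ G, 0 ≤ w G) (G : facesOf (A.chambersIn J σ)) :
    w G ≤ supportWeight w G := by
  classical
  refine le_trans (if_pos subset_rfl).ge (Finset.single_le_sum
    (f := fun H : facesOf (A.chambersIn J σ) =>
      if (G : A.Face).zeros ⊆ (H : A.Face).zeros then w H else 0)
    (fun H _ => ?_) (Finset.mem_univ G))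
  split_ifs
  exacts [hw H, le_rfl]

/-- Every face counted for `F` is still counted for `FG`, and `G` itself is new. -/
theorem supportWeight_lt (hw : ∀ G, 0 ≤ w G) (F : A.Face) {G : facesOf (A.chambersIn J σ)}
    (hG : w G ≠ 0) (hFG : ¬ F.zeros ⊆ (G : A.Face).zeros) :
    supportWeight w F < supportWeight w (F * G) := by
  classical
  refine Finset.sum_lt_sum (fun H _ => ?_) ⟨G, Finset.mem_univ G, ?_⟩
  · split_ifs with h1 h2 h2
    · exact le_rfl
    · exact absurd ((Face.zeros_mul F G ▸ Set.inter_subset_left).trans h1) h2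
    · exact hw H
    · exact le_rfl
  · rw [if_neg hFG, if_pos (Face.zeros_mul F G ▸ Set.inter_subset_right)]
    exact (hw G).lt_of_ne' hG

open scoped Classical in
theorem sub_smul_mul_mulMatrix (F : A.Face) :
    (transition (A.chambersIn J σ) w - supportWeight w F • 1) * mulMatrix (A.chambersIn J σ) F
      = ∑ G : facesOf (A.chambersIn J σ), if F.zeros ⊆ (G : A.Face).zeros then 0
        else w G • mulMatrix (A.chambersIn J σ) (F * G) := by
  rw [sub_mul, transition_eq_sum, Finset.sum_mul, smul_mul_assoc, one_mul, supportWeight,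
    Finset.sum_smul, ← Finset.sum_sub_distrib]
  refine Finset.sum_congr rfl fun G _ => ?_
  rw [smul_mul_assoc, mulMatrix_mul F G.2]
  split_ifs with h
  · rw [Face.mul_eq_left h, sub_self]
  · rw [zero_smul, sub_zero]

-- Downward triangularity: the factor `P - λ_F` turns `M_F` into terms `M_{FG}` of larger weight,
-- which the remaining factors kill by induction.
open scoped Classical in
open Polynomial in
theorem aeval_prod_mul_mulMatrix (hw : ∀ G, 0 ≤ w G) (F : facesOf (A.chambersIn J σ)) :
    aeval (transition (A.chambersIn J σ) w)
        (∏ l ∈ Finset.univ.image (fun G : facesOf (A.chambersIn J σ) => supportWeight w G)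
          with supportWeight w F ≤ l, (X - C l))
      * mulMatrix (A.chambersIn J σ) F = 0 := by
  set Λ := Finset.univ.image (fun G : facesOf (A.chambersIn J σ) => supportWeight w G) with hΛ
  have hwf : WellFounded fun F G : facesOf (A.chambersIn J σ) =>
      supportWeight w G < supportWeight w F :=
    have : IsTrans _ fun F G : facesOf (A.chambersIn J σ) =>
      supportWeight w G < supportWeight w F := ⟨fun _ _ _ h1 h2 => h2.trans h1⟩
    have : Std.Irrefl fun F G : facesOf (A.chambersIn J σ) =>
      supportWeight w G < supportWeight w F := ⟨fun _ => lt_irrefl _⟩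
    Finite.wellFounded_of_trans_of_irrefl _
  induction F using hwf.induction with
  | _ F ih =>
    have hins : (Λ.filter (supportWeight w F ≤ ·))
        = insert (supportWeight w F) (Λ.filter (supportWeight w F < ·)) := by
      ext l
      simp only [Finset.mem_filter, Finset.mem_insert]
      constructor
      · rintro ⟨h1, h2⟩
        exact h2.eq_or_lt'.imp id fun h => ⟨h1, h⟩
      · rintro (rfl | ⟨h1, h2⟩)
        · exact ⟨Finset.mem_image_of_mem _ (Finset.mem_univ F), le_rfl⟩
        · exact ⟨h1, h2.le⟩
    rw [hins, Finset.prod_insert (by simp), mul_comm, map_mul, map_sub, aeval_X, aeval_C,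
      Algebra.algebraMap_eq_smul_one, mul_assoc, sub_smul_mul_mulMatrix, Finset.mul_sum]
    refine Finset.sum_eq_zero fun G _ => ?_
    split_ifs with hFG
    · rw [mul_zero]
    by_cases hG : w G = 0
    · rw [hG, zero_smul, mul_zero]
    have hlt := supportWeight_lt hw F hG hFG
    have hsub : Λ.filter (supportWeight w (F * G : A.Face) ≤ ·)
        ⊆ Λ.filter (supportWeight w F < ·) :=
      Finset.monotone_filter_right _ fun l _ hl => hlt.trans_le hl
    have h := ih ⟨F * G, mul_mem_facesOf F.2 G.2⟩ hlt
    rw [← Finset.prod_sdiff hsub, map_mul, mul_assoc, mul_smul_comm, h, smul_zero, mul_zero]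

open Polynomial in
theorem transition_isRealDiagonalizable (hw : ∀ G, 0 ≤ w G) :
    (transition (A.chambersIn J σ) w).IsRealDiagonalizable := by
  classical
  set Λ := Finset.univ.image (fun G : facesOf (A.chambersIn J σ) => supportWeight w G) with hΛ
  -- The root 0 supplies a factor `P = ∑ w_G M_G`, which brings in the matrices `M_G`. Only `w_G >
  -- 0` matters, and then `λ_G ≥ w_G > 0`, so 0 is not a repeated root.
  refine Matrix.isRealDiagonalizable_of_prod_sub_eq_zero _ (insert 0 (Λ.filter (0 < ·))) ?_
  rw [Finset.prod_insert (by simp), mul_comm, map_mul, C_0, sub_zero, aeval_X]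
  conv_lhs => rw [transition_eq_sum, Finset.mul_sum]
  refine Finset.sum_eq_zero fun G _ => ?_
  by_cases hG : w G = 0
  · rw [hG, zero_smul, mul_zero]
  have hpos : 0 < supportWeight w G :=
    ((hw G).lt_of_ne' hG).trans_le (weight_le_supportWeight hw G)
  have hsub : Λ.filter (supportWeight w G ≤ ·) ⊆ Λ.filter (0 < ·) :=
    Finset.monotone_filter_right _ fun l _ hl => hpos.trans_le hl
  rw [← transition_eq_sum, ← Finset.prod_sdiff hsub, map_mul, mul_assoc, mul_smul_comm,
    aeval_prod_mul_mulMatrix hw G, smul_zero, mul_zero]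

end Diagonalizable

/-! ### Traces of powers. -/

section Trace

variable [Finite I] {J : Set I} {σ : I → SignType}

-- `GC = C` means that `C` has the nonzero signs of `G`. Adding these signs to those on `J` cuts out
-- a smaller open region, and Zaslavsky's formula applies there.
open scoped Classical in
theorem trace_mulMatrix (hσ : ∀ i ∈ J, σ i ≠ 0) {G : A.Face}
    (hG : G ∈ facesOf (A.chambersIn J σ)) :
    (mulMatrix (A.chambersIn J σ) G).trace
      = ∑ X : A.flatsMeeting (A.openRegion J σ),
        if G.carrier ⊆ X.1.1 then (absMobius (X : A.Flat) : ℝ) else 0 := by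
  obtain ⟨C₀, hC₀, hGC⟩ := hG
  let K : Set I := J ∪ {i | G.sgn i ≠ 0}
  let τ : I → SignType := fun i => if G.sgn i ≠ 0 then G.sgn i else σ i
  have hGσ : ∀ i ∈ J, G.sgn i ≠ 0 → G.sgn i = σ i := fun i hi h => by
    rw [(hGC i).resolve_left h, hC₀.2 i hi]
  have hτJ : ∀ i ∈ J, τ i = σ i := by
    intro i hi
    simp only [τ]
    split_ifs with h
    · exact hGσ i hi h
    · rfl
  have hτ : ∀ i ∈ K, τ i ≠ 0 := by
    rintro i (hi | hi)
    · rw [hτJ i hi]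
      exact hσ i hi
    · exact (if_pos hi).trans_ne hi
  have hmem : ∀ C : A.Face, C ∈ A.chambersIn K τ ↔ C ∈ A.chambersIn J σ ∧ G * C = C := by
    intro C
    constructor
    · rintro ⟨h1, h2⟩
      refine ⟨⟨h1, fun i hi => (h2 i (Or.inl hi)).trans (hτJ i hi)⟩, ?_⟩
      ext i
      rw [Face.mul_sgn]
      split_ifs with h
      · exact ((h2 i (Or.inr h)).trans (if_pos h)).symm
      · rfl
    · rintro ⟨⟨h1, h2⟩, h3⟩
      refine ⟨h1, ?_⟩
      rintro i (hi | hi)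
      · rw [hτJ i hi, h2 i hi]
      · rw [← h3, Face.mul_sgn]
        exact (if_pos hi).trans (if_pos hi).symm
  have hflat : ∀ X : A.Flat, X ∈ A.flatsMeeting (A.openRegion K τ) ↔
      X ∈ A.flatsMeeting (A.openRegion J σ) ∧ G.carrier ⊆ X.1 := by
    intro X
    constructor
    · rintro ⟨v, hvX, hv⟩
      refine ⟨⟨v, hvX, fun i hi => (hv i (Or.inl hi)).trans (hτJ i hi)⟩,
        Face.carrier_subset_iff.2 fun i hi => ?_⟩
      by_contra h
      have h1 := hv i (Or.inr h)
      rw [Flat.mem_iff.1 hvX i hi, sign_zero] at h1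
      exact hτ i (Or.inr h) h1.symm
    · rintro ⟨⟨v, hvX, hv⟩, hGX⟩
      obtain ⟨g, hg⟩ := G.carrier_nonempty
      -- A point near `g ∈ G` towards `v ∈ X ∩ U` lies in `X` and in the smaller region.
      obtain ⟨u, hu⟩ := A.exists_signSeq_eq_mul g v
      have hu' : ∀ i, SignType.sign (A.form i u)
          = if G.sgn i ≠ 0 then G.sgn i else SignType.sign (A.form i v) := by
        intro i
        rw [← hg i]
        exact congrFun hu i
      refine ⟨u, Flat.mem_iff.2 fun i hi => ?_, ?_⟩
      · have h1 : G.sgn i = 0 := Face.carrier_subset_iff.1 hGX hi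
        rw [← sign_eq_zero_iff, hu', h1, Flat.mem_iff.1 hvX i hi]
        simp
      · rintro i (hi | hi)
        · rw [hu', hv i hi]
        · rw [hu']
          exact (if_pos hi).trans (if_pos hi).symm
  have h1 : (mulMatrix (A.chambersIn J σ) G).trace = Fintype.card (A.chambersIn K τ) := by
    simp only [Matrix.trace, Matrix.diag_apply, mulMatrix]
    rw [← Finset.sum_subtype (Finset.univ.filter (· ∈ A.chambersIn J σ))
      (fun C => Finset.mem_filter_univ C) (fun C => if G * C = C then (1 : ℝ) else 0),
      Finset.sum_boole, Finset.filter_filter, Fintype.card_subtype]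
    simp only [hmem]
  rw [h1, card_chambersIn hτ, Nat.cast_sum,
    ← Finset.sum_subtype (Finset.univ.filter (· ∈ A.flatsMeeting (A.openRegion J σ)))
      (fun X => Finset.mem_filter_univ X)
      (fun X : A.Flat => if G.carrier ⊆ X.1 then (absMobius X : ℝ) else 0),
    ← Finset.sum_subtype (Finset.univ.filter (· ∈ A.flatsMeeting (A.openRegion K τ)))
      (fun X => Finset.mem_filter_univ X) (fun X : A.Flat => (absMobius X : ℝ)),
    ← Finset.sum_filter, Finset.filter_filter]
  simp only [hflat]

-- The extra factor `M_F` makes the induction run: one factor `P` replaces `F` by `FG`, and `FG ⊆ X`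
-- splits into `F ⊆ X` and `G ⊆ X`.
open scoped Classical in
theorem trace_transition_pow_mul (hσ : ∀ i ∈ J, σ i ≠ 0)
    (w : facesOf (A.chambersIn J σ) → ℝ) (m : ℕ) (F : A.Face)
    (hF : F ∈ facesOf (A.chambersIn J σ)) :
    (transition (A.chambersIn J σ) w ^ m * mulMatrix (A.chambersIn J σ) F).trace
      = ∑ X : A.flatsMeeting (A.openRegion J σ),
        if F.carrier ⊆ X.1.1 then
          (absMobius (X : A.Flat) : ℝ) * flatWeight (A.chambersIn J σ) w X ^ m else 0 := by
  induction m generalizing F with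
  | zero => simpa using trace_mulMatrix hσ hF
  | succ m ih =>
    rw [pow_succ, mul_assoc]
    conv_lhs => enter [1, 2]; rw [transition_eq_sum, Finset.sum_mul]
    rw [Finset.mul_sum, Matrix.trace_sum]
    have h : ∀ G : facesOf (A.chambersIn J σ), (transition (A.chambersIn J σ) w ^ m *
        (w G • mulMatrix (A.chambersIn J σ) G * mulMatrix (A.chambersIn J σ) F)).trace
        = ∑ X : A.flatsMeeting (A.openRegion J σ), if F.carrier ⊆ X.1.1 then
          (absMobius (X : A.Flat) : ℝ) * flatWeight (A.chambersIn J σ) w X ^ m *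
            (if (G : A.Face).carrier ⊆ X.1.1 then w G else 0) else 0 := by
      intro G
      rw [smul_mul_assoc, mulMatrix_mul F G.2, mul_smul_comm, Matrix.trace_smul,
        ih _ (mul_mem_facesOf hF G.2), smul_eq_mul, Finset.mul_sum]
      refine Finset.sum_congr rfl fun X _ => ?_
      simp only [Face.carrier_subset_iff, Face.zeros_mul, Set.subset_inter_iff]
      split_ifs <;> simp_all [mul_comm]
    simp only [h]
    rw [Finset.sum_comm]
    refine Finset.sum_congr rfl fun X _ => ?_
    split_ifs
    · rw [← Finset.mul_sum, pow_succ, mul_assoc, flatWeight]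
    · simp

theorem trace_transition_pow (hσ : ∀ i ∈ J, σ i ≠ 0)
    (w : facesOf (A.chambersIn J σ) → ℝ) (m : ℕ) :
    (transition (A.chambersIn J σ) w ^ m).trace
      = ∑ X : A.flatsMeeting (A.openRegion J σ),
          (absMobius (X : A.Flat) : ℝ) * flatWeight (A.chambersIn J σ) w X ^ m := by
  classical
  cases m with
  -- The identity matrix need not be some `M_F`, so the zeroth power is Zaslavsky's formula
  -- directly.
  | zero => simp [card_chambersIn hσ]
  | succ m =>
    rw [pow_succ]
    conv_lhs => enter [1, 2]; rw [transition_eq_sum]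
    rw [Finset.mul_sum, Matrix.trace_sum]
    simp only [mul_smul_comm, Matrix.trace_smul, trace_transition_pow_mul hσ w m _ (Subtype.prop _),
      smul_eq_mul, Finset.mul_sum]
    rw [Finset.sum_comm]
    refine Finset.sum_congr rfl fun X _ => ?_
    rw [pow_succ, ← mul_assoc, flatWeight, Finset.mul_sum]
    refine Finset.sum_congr rfl fun G _ => ?_
    split_ifs <;> simp [mul_comm]

end Trace

end HypArrangement

theorem mainTheorem5 {V : Type*} [AddCommGroup V] [Module ℝ V] {I : Type*} [Finite I]
    (A : HypArrangement V I)
    (J : Set I) (σ : I → SignType) (hσ : ∀ i ∈ J, σ i ≠ 0)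
    (D : Set A.Face) (hD : D = A.chambersIn J σ) (hne : D.Nonempty)
    (w : HypArrangement.facesOf D → ℝ) (hw_nonneg : ∀ G, 0 ≤ w G) (hw_sum : ∑ G, w G = 1) :
    (HypArrangement.transition D w).IsRealDiagonalizable ∧
    (∀ X ∈ A.flatsMeeting (A.openRegion J σ),
      Module.End.HasEigenvalue (Matrix.toLin' (HypArrangement.transition D w))
        (HypArrangement.flatWeight D w X)) ∧
    (HypArrangement.transition D w).charpoly =
      ∏ X : A.flatsMeeting (A.openRegion J σ),
        (Polynomial.X - Polynomial.C (HypArrangement.flatWeight D w X)) ^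
          HypArrangement.absMobius (X : A.Flat) := by
  subst hD
  have hdiag := HypArrangement.transition_isRealDiagonalizable hw_nonneg
  have hchar := hdiag.charpoly_eq
    (fun X : A.flatsMeeting (A.openRegion J σ) => HypArrangement.flatWeight _ w X)
    (fun X => HypArrangement.absMobius (X : A.Flat))
    (HypArrangement.trace_transition_pow hσ w)
  refine ⟨hdiag, fun X hX => ?_, hchar⟩
  rw [Module.End.hasEigenvalue_iff_isRoot_charpoly, Matrix.charpoly_toLin', hchar,
    Polynomial.IsRoot.def, Polynomial.eval_prod]
  refine Finset.prod_eq_zero (Finset.mem_univ ⟨X, hX⟩) ?_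
  -- The factor of `X` vanishes at `λ_X` because its exponent is nonzero.
  simp [HypArrangement.absMobius_ne_zero]
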